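/- All graphs are finite and simple, $|G|$ denotes the number of vertices of $G$, and $\rho_G(v)$ the valency (degree) of $v$ in $G$. Call $G$ 2-connected if $|G|\ge 3$ and $G$ remains connected after the removal of fewer than two vertices. Let $K_{1,3}$ be the claw and let $Z_2$ be the graph on five vertices $a,b,c,d,e$ with edges $ab,ac,bc,cd,de$ (a triangle with a path of length two attached at one of its vertices). Theorem. Let $G$ be a 2-connected graph. Suppose that for every induced subgraph $L$ of $G$ that is isomorphic to $K_{1,3}$ or to $Z_2$, the localized condition $D_L(2)$ holds: for all $x,y\in V(L)$ whose distance in $L$ is $2$, $\max\{\rho_G(x),\rho_G(y)\}\ge |G|/2$. Then $G$ is hamiltonian, that is, $G$ has a cycle containing all its vertices. Corollary. Every 2-connected graph that has no induced subgraph isomorphic to $K_{1,3}$ and none isomorphic to $Z_2$ is hamiltonian. -/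

import Mathlib

namespace LocalizedHamiltonian

/-- The claw `K_{1,3}`. -/
abbrev claw : SimpleGraph (Fin 1 ⊕ Fin 3) := completeBipartiteGraph (Fin 1) (Fin 3)

/-- The graph `Z_2`: a triangle `0, 1, 2` with a path `2, 3, 4` of length two attached at one of its
vertices. -/
def Z₂ : SimpleGraph (Fin 5) :=
  SimpleGraph.fromEdgeSet {s(0, 1), s(0, 2), s(1, 2), s(2, 3), s(3, 4)}

/-- A finite graph is `k`-connected if it has more than `k` vertices and it remains connected
whenever fewer than `k` vertices are removed. -/
def IsKConnected {V : Type*} [Fintype V] (G : SimpleGraph V) (k : ℕ) : Prop :=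
  k < Fintype.card V ∧
    ∀ S : Finset V, S.card < k → (G.induce {v : V | v ∉ S}).Connected

/-- The localized condition `D_L(l)` for the induced subgraph `L` of `G` on the vertex set `S`: of
any two vertices whose distance in `L` is `l`, at least one has valency at least `|G| / 2` in `G`.
The extended distance is used, so that vertices in different components of `L` have distance `⊤`. -/
def LocalizedCondition {V : Type*} [Fintype V] (G : SimpleGraph V) [DecidableRel G.Adj]
    (S : Set V) (l : ℕ) : Prop :=
  ∀ x y : S, (G.induce S).edist x y = (l : ℕ∞) →
    (Fintype.card V : ℚ) / 2 ≤ max (G.degree (x : V) : ℚ) (G.degree (y : V) : ℚ)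

end LocalizedHamiltonian

/-! Call a vertex heavy if its valency is at least half of `|G|`, light otherwise, and let `H` be
the set of heavy vertices. Of two vertices at distance two in an induced claw or `Z₂`, one is heavy.
By Ore's argument the vertices of any cycle that uses extra edges between heavy vertices already lie
on a cycle of `G` (`exists_cycle_of_addClique`). Hence `G` has a cycle `C` through `H` that is at
least as long as any cycle through `H` in the graph with `H` made a clique (`Extremal`). In looking
for longer cycles two heavy vertices may thus be treated as joined, while all vertices off `C` are
light.

If `C` misses a vertex, 2-connectedness gives a shortest ear from `p` to `q`. Its first vertex is
light, so the claw condition at `p` joins the two cycle neighbours of `p`, by an edge of `G` or as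
heavy vertices. If the ear has at least two inner vertices, or one while `p` and `q` are not
adjacent, the `Z₂` condition makes both these neighbours heavy. The same holds at `q`, and joining
the successors of `p` and `q` gives a longer cycle (`false_of_long`, `adj_of_single`).

There remains a triangle `u p q` with `u` off `C`. Let `x` be the first vertex after `p` on `C` not
adjacent to `p`, and `y` its predecessor. The `Z₂` with triangle `u q p` and tail `y x` makes `y`
heavy, and `p` or `x` as well; since `q` and `y` cannot be joined, `q` is light. By symmetry `p` is
light, so `x` and its counterpart `w` after `q` are heavy, and the edge `xw` allows a cycle through
`u` and all of `C` (`false_of_single`). -/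

namespace LocalizedHamiltonian

open SimpleGraph

/-! ### Walks as vertex lists -/

section

variable {V : Type*}

/-- The list `l` is a walk of `K` from `a` to `b`. -/
structure WalkList (K : SimpleGraph V) (a : V) (l : List V) (b : V) : Prop where
  chain : l.IsChain K.Adj
  head : l.head? = some a
  last : l.getLast? = some b

namespace WalkList

variable {K K' : SimpleGraph V} {a b c d : V} {l m : List V}

theorem single (K : SimpleGraph V) (a : V) : WalkList K a [a] a := ⟨by simp, by simp, by simp⟩

theorem append (h : WalkList K a l b) (hbc : K.Adj b c) (h' : WalkList K c m d) :
    WalkList K a (l ++ m) d := by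
  refine ⟨List.isChain_append.2 ⟨h.chain, h'.chain, ?_⟩, ?_, ?_⟩
  · simp [h.last, h'.head, hbc]
  · simp [h.head]
  · simp [h'.last]

theorem cons (hab : K.Adj a b) (h : WalkList K b l c) : WalkList K a (a :: l) c :=
  (single K a).append hab h

theorem reverse (h : WalkList K a l b) : WalkList K b l.reverse a := by
  refine ⟨?_, by simp [h.last], by simp [h.head]⟩
  rw [List.isChain_reverse]
  exact h.chain.imp fun _ _ => fun h => h.symm

theorem mono (hK : ∀ x ∈ l, ∀ y ∈ l, K.Adj x y → K'.Adj x y) (h : WalkList K a l b) :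
    WalkList K' a l b := by
  refine ⟨?_, h.head, h.last⟩
  exact List.IsChain.imp_of_mem_imp (fun x y hx hy hxy => hK x hx y hy hxy) h.chain

theorem ne_nil (h : WalkList K a l b) : l ≠ [] := by
  rintro rfl
  simpa using h.head

theorem head_mem (h : WalkList K a l b) : a ∈ l := List.mem_of_mem_head? h.head

theorem last_mem (h : WalkList K a l b) : b ∈ l := List.mem_of_mem_getLast? h.last

theorem exists_of_ne_nil (h : l.IsChain K.Adj) (hl : l ≠ []) : ∃ a b, WalkList K a l b :=
  ⟨l.head hl, l.getLast hl, h, List.head?_eq_some_head hl, List.getLast?_eq_some_getLast hl⟩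

/-- Split a walk in two at an interior edge. -/
theorem split (h : WalkList K a (l ++ m) b) (hl : l ≠ []) (hm : m ≠ []) :
    ∃ c d, WalkList K a l c ∧ K.Adj c d ∧ WalkList K d m b := by
  obtain ⟨h1, h2, h3⟩ := List.isChain_append.1 h.chain
  obtain ⟨a', c, hc⟩ := exists_of_ne_nil h1 hl
  obtain ⟨d, b', hd⟩ := exists_of_ne_nil h2 hm
  have ha : a' = a := by simpa [hc.head] using h.head
  have hb : b' = b := by simpa [hd.last] using h.last
  subst ha hb
  exact ⟨c, d, hc, h3 c hc.last d hd.head, hd⟩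

/-- Split a walk at its first vertex outside `P`. -/
theorem split_first (P : V → Prop) (h : WalkList K a l b) (ha : P a) (hb : ¬ P b) :
    ∃ l₁ l₂ y x, l = l₁ ++ l₂ ∧ WalkList K a l₁ y ∧ K.Adj y x ∧ WalkList K x l₂ b ∧
      (∀ v ∈ l₁, P v) ∧ ¬ P x := by
  classical
  have hsplit : l = l.takeWhile (fun v => decide (P v)) ++ l.dropWhile (fun v => decide (P v)) :=
    (List.takeWhile_append_dropWhile).symm
  have h1 : l.takeWhile (fun v => decide (P v)) ≠ [] := by
    have := h.head
    cases l with
    | nil => simp at this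
    | cons v t => simp at this; subst this; simp [ha]
  have h2 : l.dropWhile (fun v => decide (P v)) ≠ [] := by
    intro h0
    rw [List.dropWhile_eq_nil_iff] at h0
    exact hb (by simpa using h0 b h.last_mem)
  have h' := h
  rw [hsplit] at h'
  obtain ⟨y, x, hy, hyx, hx⟩ := h'.split h1 h2
  refine ⟨_, _, y, x, hsplit, hy, hyx, hx, fun v hv => by simpa using List.mem_takeWhile_imp hv, ?_⟩
  have := List.head_dropWhile_not (fun v => decide (P v)) h2
  have hx' := hx.head
  rw [List.head?_eq_some_head h2] at hx'
  simp only [Option.some.injEq] at hx'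
  rw [hx'] at this
  simpa using this

/-- A walk is a single vertex or has a last edge. -/
theorem eq_single_or_concat (h : WalkList K a l b) :
    (l = [a] ∧ a = b) ∨ ∃ m c, l = m ++ [b] ∧ WalkList K a m c ∧ K.Adj c b := by
  obtain ⟨m, hm⟩ : ∃ m, l = m ++ [b] := List.getLast?_eq_some_iff.1 h.last
  subst hm
  by_cases hm : m = []
  · subst hm
    have := h.head
    simp at this
    subst this
    simp
  · obtain ⟨c, d, h1, h2, h3⟩ := h.split hm (by simp)
    have := h3.head
    simp at this
    subst this
    exact Or.inr ⟨m, c, rfl, h1, h2⟩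

end WalkList

/-! ### Extremal cycles and their ears -/

/-- The graph obtained from `G` by turning `H` into a clique. -/
def addClique (G : SimpleGraph V) (H : Set V) : SimpleGraph V where
  Adj x y := G.Adj x y ∨ (x ≠ y ∧ x ∈ H ∧ y ∈ H)
  symm := ⟨fun _ _ h => h.imp (·.symm) fun ⟨h, hx, hy⟩ => ⟨h.symm, hy, hx⟩⟩
  loopless := ⟨fun _ h => h.elim (G.loopless.irrefl _) fun h => h.1 rfl⟩

/-- `H` meets every induced claw and every induced `Z₂` of `G` as heavy vertices do, and `n` bounds
the lengths of the cycles through `H` in the graph in which `H` is made a clique. -/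
structure Extremal (G : SimpleGraph V) (H : Set V) (n : ℕ) : Prop where
  claw : ∀ c x y z, G.Adj c x → G.Adj c y → G.Adj c z → x ≠ y → x ≠ z → y ≠ z →
    ¬ G.Adj x y → ¬ G.Adj x z → ¬ G.Adj y z → x ∉ H → y ∈ H ∧ z ∈ H
  Z₂ : ∀ a b c d e, G.Adj a b → G.Adj a c → G.Adj b c → G.Adj c d → G.Adj d e →
    ¬ G.Adj a d → ¬ G.Adj a e → ¬ G.Adj b d → ¬ G.Adj b e → ¬ G.Adj c e →
    (d ∈ H ∨ a ∈ H ∧ b ∈ H) ∧ (c ∈ H ∨ e ∈ H)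
  length_le : ∀ c l d, WalkList (addClique G H) c l d → (addClique G H).Adj d c → l.Nodup →
    3 ≤ l.length → (∀ h ∈ H, h ∈ l) → l.length ≤ n

/-- A cycle `p A q B` of length `n` through `H`, where `A` runs from `a` to `a'` and `B` from `b`
to `b'`, with a path `Q` from a neighbour `r` of `p` to a neighbour `s` of `q` off the cycle. -/
structure Ear (G : SimpleGraph V) (H : Set V) (n : ℕ) (r s p q a a' b b' : V)
    (Q A B : List V) : Prop where
  walkQ : WalkList G r Q s
  walkA : WalkList G a A a'
  walkB : WalkList G b B b'
  adj_pr : G.Adj p r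
  adj_sq : G.Adj s q
  adj_pa : G.Adj p a
  adj_aq : G.Adj a' q
  adj_qb : G.Adj q b
  adj_bp : G.Adj b' p
  nodup : (Q ++ p :: q :: (A ++ B)).Nodup
  length_eq : A.length + B.length + 2 = n
  mem_of_heavy : ∀ h ∈ H, h ∈ p :: q :: (A ++ B)

namespace Ear

variable {G : SimpleGraph V} {H : Set V} {n : ℕ} {r s p q a a' b b' u : V} {Q A B : List V}

/-- With `rev`, this reduces every claim to one end of the ear and one direction: `swap` exchanges
the ends and keeps the orientation of the cycle, `rev` keeps the ends and reverses it. -/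
theorem swap (E : Ear G H n r s p q a a' b b' Q A B) :
    Ear G H n s r q p b b' a a' Q.reverse B A where
  walkQ := E.walkQ.reverse
  walkA := E.walkB
  walkB := E.walkA
  adj_pr := E.adj_sq.symm
  adj_sq := E.adj_pr.symm
  adj_pa := E.adj_qb
  adj_aq := E.adj_bp
  adj_qb := E.adj_pa
  adj_bp := E.adj_aq
  nodup := by
    refine (List.Perm.nodup_iff ?_).1 E.nodup
    classical
    rw [List.perm_iff_count]
    intro v
    simp only [List.count_append, List.count_cons, List.count_reverse]
    omega
  length_eq := by rw [← E.length_eq]; omega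
  mem_of_heavy h hh := by have := E.mem_of_heavy h hh; simp at this ⊢; tauto

theorem rev (E : Ear G H n r s p q a a' b b' Q A B) :
    Ear G H n r s p q b' b a' a Q B.reverse A.reverse where
  walkQ := E.walkQ
  walkA := E.walkB.reverse
  walkB := E.walkA.reverse
  adj_pr := E.adj_pr
  adj_sq := E.adj_sq
  adj_pa := E.adj_bp.symm
  adj_aq := E.adj_qb.symm
  adj_qb := E.adj_aq.symm
  adj_bp := E.adj_pa.symm
  nodup := by
    refine (List.Perm.nodup_iff ?_).1 E.nodup
    classical
    rw [List.perm_iff_count]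
    intro v
    simp only [List.count_append, List.count_cons, List.count_reverse]
    omega
  length_eq := by rw [← E.length_eq]; simp; omega
  mem_of_heavy h hh := by have := E.mem_of_heavy h hh; simp at this ⊢; tauto

theorem not_heavy (E : Ear G H n r s p q a a' b b' Q A B) {v : V} (hv : v ∈ Q) : v ∉ H :=
  fun hH => (List.disjoint_of_nodup_append E.nodup) hv (E.mem_of_heavy v hH)

/-- There is no cycle through the given one and further vertices of `Q`. -/
theorem no_longer (E : Ear G H n r s p q a a' b b' Q A B) (S : Extremal G H n) {c d : V}
    {l Q' : List V} (hl : WalkList (addClique G H) c l d) (hdc : (addClique G H).Adj d c)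
    (hQ' : Q'.Sublist Q) (hne : Q' ≠ []) (hperm : l.Perm (Q' ++ p :: q :: (A ++ B))) : False := by
  have hnd : l.Nodup := by
    rw [hperm.nodup_iff]
    exact E.nodup.sublist (List.Sublist.append_right hQ' _)
  have hlen := hperm.length_eq
  have hpos := List.length_pos_of_ne_nil hne
  simp at hlen
  have h1 := E.length_eq
  have := S.length_le c l d hl hdc hnd (by omega) fun h hh => by
    rw [hperm.mem_iff]
    exact List.mem_append_right _ (E.mem_of_heavy h hh)
  omega

theorem pred_ne_succ (E : Ear G H n r s p q a a' b b' Q A B) : b' ≠ a := by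
  rintro rfl
  have h := E.nodup.of_append_right
  simp only [List.nodup_cons, List.nodup_append] at h
  exact h.2.2.2.2 _ E.walkA.head_mem _ E.walkB.last_mem rfl

/-- If `y` and `z` are not adjacent in `G`, there is a claw with the leaf `x` outside `H`, so the
other two leaves lie in `H` and the clique joins them. -/
theorem adj_of_claw (S : Extremal G H n) {c x y z : V} (hx : G.Adj c x) (hy : G.Adj c y)
    (hz : G.Adj c z) (hxy : ¬ G.Adj x y) (hxz : ¬ G.Adj x z) (hnxy : x ≠ y) (hnxz : x ≠ z)
    (hyz : y ≠ z) (hH : x ∉ H) : (LocalizedHamiltonian.addClique G H).Adj y z := by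
  by_cases h : G.Adj y z
  · exact Or.inl h
  · exact Or.inr ⟨hyz, S.claw c x y z hx hy hz hnxy hnxz hyz hxy hxz h hH⟩

theorem ne_of_mem (E : Ear G H n r s p q a a' b b' Q A B) {v w : V} (hv : v ∈ Q)
    (hw : w ∈ p :: q :: (A ++ B)) : v ≠ w := by
  rintro rfl
  exact List.disjoint_of_nodup_append E.nodup hv hw

end Ear

end

/-! ### Excluding ears by rerouting the cycle -/

section

variable {V : Type*}

theorem le_addClique (G : SimpleGraph V) (H : Set V) : G ≤ addClique G H := fun _ _ => Or.inl

theorem WalkList.addClique {G : SimpleGraph V} {a b : V} {l : List V} (h : WalkList G a l b)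
    (H : Set V) : WalkList (addClique G H) a l b :=
  h.mono fun _ _ _ _ hxy => Or.inl hxy

namespace Ear

variable [DecidableEq V] {G : SimpleGraph V} {H : Set V} {n : ℕ} {r s p q a a' b b' u : V}
  {Q A B : List V}

/-- Otherwise `r` could be inserted into the cycle between `p` and `a`. -/
theorem not_adj_head (E : Ear G H n r s p q a a' b b' Q A B) (S : Extremal G H n) :
    ¬ (LocalizedHamiltonian.addClique G H).Adj r a := by
  intro h
  have hle := le_addClique G H
  refine E.no_longer S (Q' := [r]) (l := [r] ++ (A ++ ([q] ++ (B ++ [p]))))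
    ((WalkList.single _ r).append h ((E.walkA.addClique H).append (hle E.adj_aq)
      ((WalkList.single _ q).append (hle E.adj_qb) ((E.walkB.addClique H).append (hle E.adj_bp)
        (WalkList.single _ p))))) (hle E.adj_pr) ?_ (by simp) ?_
  · simpa using E.walkQ.head_mem
  · refine List.perm_iff_count.2 fun v => ?_
    simp only [List.count_append, List.count_cons, List.count_nil]
    omega

theorem not_adj_second {w : V} (E : Ear G H n r s p q a a' b b' (r :: w :: Q) A B)
    (S : Extremal G H n) : ¬ (LocalizedHamiltonian.addClique G H).Adj w a := by
  intro h
  have hle := le_addClique G H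
  have hrw : G.Adj r w := (List.isChain_cons_cons.1 E.walkQ.chain).1
  refine E.no_longer S (Q' := [r, w]) (l := [r] ++ ([w] ++ (A ++ ([q] ++ (B ++ [p])))))
    ((WalkList.single _ r).append (hle hrw) ((WalkList.single _ w).append h
      ((E.walkA.addClique H).append (hle E.adj_aq)
      ((WalkList.single _ q).append (hle E.adj_qb) ((E.walkB.addClique H).append (hle E.adj_bp)
        (WalkList.single _ p)))))) (hle E.adj_pr) (by simp) (by simp) ?_
  refine List.perm_iff_count.2 fun v => ?_
  simp only [List.count_append, List.count_cons, List.count_nil]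
  omega

/-- The successors of `p` and `q` on the cycle are not adjacent. -/
theorem not_adj_succ (E : Ear G H n r s p q a a' b b' Q A B) (S : Extremal G H n) :
    ¬ (LocalizedHamiltonian.addClique G H).Adj a b := by
  intro h
  have hle := le_addClique G H
  -- Traverse the ear from `p` to `q`, then `A` backwards, and cross from `a` to `b`.
  refine E.no_longer S (Q' := Q) (l := [p] ++ (Q ++ ([q] ++ (A.reverse ++ B))))
    ((WalkList.single _ p).append (hle E.adj_pr) ((E.walkQ.addClique H).append (hle E.adj_sq)
      ((WalkList.single _ q).append (hle E.adj_aq.symm) ((E.walkA.addClique H).reverse.append h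
        (E.walkB.addClique H))))) (hle E.adj_bp) (List.Sublist.refl _) E.walkQ.ne_nil ?_
  refine List.perm_iff_count.2 fun v => ?_
  simp only [List.count_append, List.count_cons, List.count_nil, List.count_reverse]
  omega

/-- `q` is not adjacent to the successor of `p` if its two neighbours on the cycle are adjacent. -/
theorem not_adj_of_adj (E : Ear G H n r s p q a a' b b' Q A B) (S : Extremal G H n)
    (hab : (LocalizedHamiltonian.addClique G H).Adj a' b) :
    ¬ (LocalizedHamiltonian.addClique G H).Adj q a := by
  intro h
  have hle := le_addClique G H
  -- Here `q` moves to the front of `A`, and the edge from `a'` to `b` closes the gap it leaves.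
  refine E.no_longer S (Q' := Q) (l := [p] ++ (Q ++ ([q] ++ (A ++ B))))
    ((WalkList.single _ p).append (hle E.adj_pr) ((E.walkQ.addClique H).append (hle E.adj_sq)
      ((WalkList.single _ q).append h ((E.walkA.addClique H).append hab
        (E.walkB.addClique H))))) (hle E.adj_bp) (List.Sublist.refl _) E.walkQ.ne_nil ?_
  refine List.perm_iff_count.2 fun v => ?_
  simp only [List.count_append, List.count_cons, List.count_nil]
  omega

/-- In the star at `p` with leaves `r`, `b'`, `a`, the leaf `r` is outside `H` and adjacent to
neither of the others. -/
theorem adj_pred_succ (E : Ear G H n r s p q a a' b b' Q A B) (S : Extremal G H n) :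
    (LocalizedHamiltonian.addClique G H).Adj b' a := by
  have hle := le_addClique G H
  refine adj_of_claw S E.adj_pr E.adj_bp.symm E.adj_pa (fun h => E.rev.not_adj_head S (hle h))
    (fun h => E.not_adj_head S (hle h)) ?_ ?_ E.pred_ne_succ (E.not_heavy E.walkQ.head_mem)
  · exact E.ne_of_mem E.walkQ.head_mem (by simp [E.walkB.last_mem])
  · exact E.ne_of_mem E.walkQ.head_mem (by simp [E.walkA.head_mem])

/-- Both neighbours of `p` on the cycle are in `H` if some neighbour of `r` is adjacent neither
to `p` nor to them. -/
theorem mem_of_adj (E : Ear G H n r s p q a a' b b' Q A B) (S : Extremal G H n) {e : V}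
    (hre : G.Adj r e) (hpe : ¬ G.Adj p e) (hae : ¬ G.Adj a e) (hbe : ¬ G.Adj b' e) :
    a ∈ H ∧ b' ∈ H := by
  have hle := le_addClique G H
  have hr := E.not_heavy E.walkQ.head_mem
  have h1 : ¬ G.Adj r b' := fun h => E.rev.not_adj_head S (hle h)
  have h2 : ¬ G.Adj r a := fun h => E.not_adj_head S (hle h)
  -- An edge `ab'` gives a `Z₂` with triangle `a b' p` and tail `r e`, where `r` is outside `H`.
  -- Without it, the join of `b'` and `a` can only come from the clique.
  by_cases h : G.Adj a b'
  · exact (S.Z₂ a b' p r e h E.adj_pa.symm E.adj_bp E.adj_pr hre (fun h => h2 h.symm) hae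
      (fun h => h1 h.symm) hbe hpe).1.resolve_left hr
  · exact ((E.adj_pred_succ S).resolve_left fun h' => h h'.symm).2.symm

theorem not_adj_of_mem (E : Ear G H n r s p q a a' b b' Q A B) (S : Extremal G H n)
    (ha : a ∈ H) (hb : b ∈ H) : False := by
  refine E.not_adj_succ S (Or.inr ⟨?_, ha, hb⟩)
  rintro rfl
  have h := E.nodup.of_append_right
  simp only [List.nodup_cons, List.nodup_append] at h
  exact h.2.2.2.2 _ E.walkA.head_mem _ E.walkB.head_mem rfl

/-- No ear with at least two inner vertices is locally shortest. -/
theorem false_of_long {w w' : V} {Q₁ Q₂ : List V} (E : Ear G H n r s p q a a' b b' Q A B)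
    (S : Extremal G H n) (hQ : Q = r :: w :: Q₁) (hQ' : Q.reverse = s :: w' :: Q₂)
    (hpw : ¬ G.Adj p w) (hqw : ¬ G.Adj q w') : False := by
  have key : ∀ {r s p q a a' b b' : V} {Q A B : List V} {w : V} {Q₁ : List V},
      Ear G H n r s p q a a' b b' Q A B → Q = r :: w :: Q₁ → ¬ G.Adj p w → a ∈ H ∧ b' ∈ H := by
    intro r s p q a a' b b' Q A B w Q₁ E hQ hpw
    subst hQ
    have hle := le_addClique G H
    exact E.mem_of_adj S (List.isChain_cons_cons.1 E.walkQ.chain).1 hpw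
      (fun h => E.not_adj_second S (hle h.symm)) (fun h => E.rev.not_adj_second S (hle h.symm))
  exact E.not_adj_of_mem S (key E hQ hpw).1 (key E.swap hQ' hqw).1

/-- If `p` and `q` were not adjacent, `q` could serve as the vertex `e` of `mem_of_adj` at `p`:
since the cycle neighbours of `q` are joined, `q` is adjacent to neither `a` nor `b'`. The same at
`q` puts `a` and `b` in `H`. -/
theorem adj_of_single (E : Ear G H n u u p q a a' b b' [u] A B) (S : Extremal G H n) :
    G.Adj p q := by
  by_contra hpq
  have key : ∀ {p q a a' b b' : V} {A B : List V}, Ear G H n u u p q a a' b b' [u] A B →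
      ¬ G.Adj p q → a ∈ H ∧ b' ∈ H := by
    intro p q a a' b b' A B E hpq
    have hle := le_addClique G H
    exact E.mem_of_adj S E.adj_sq hpq
      (fun h => E.not_adj_of_adj S (E.swap.adj_pred_succ S) (hle h.symm))
      (fun h => E.rev.not_adj_of_adj S (E.swap.adj_pred_succ S).symm (hle h.symm))
  exact E.not_adj_of_mem S (key E hpq).1 (key E.swap fun h => hpq h.symm).1

/-- Follow the cycle from `p` to the first vertex not adjacent to `p`. -/
theorem exists_stretch (E : Ear G H n u u p q a a' b b' [u] A B) (S : Extremal G H n) :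
    ∃ A₁ A₂ y x, A = A₁ ++ A₂ ∧ WalkList G a A₁ y ∧ WalkList G x A₂ a' ∧ G.Adj y p ∧
      q ∉ H ∧ (p ∈ H ∨ x ∈ H) := by
  have hle := le_addClique G H
  have hpq := E.adj_of_single S
  have hab := E.swap.adj_pred_succ S
  have hba := E.adj_pred_succ S
  -- Since `b'` and `a` are joined, `p` misses `a'`; so the stretch of neighbours of `p` ends within
  -- `A`.
  have hpa' : ¬ G.Adj p a' := fun h =>
    E.swap.rev.not_adj_of_adj S hba.symm (hle h)
  obtain ⟨A₁, A₂, y, x, rfl, hA₁, hyx, hA₂, hP, hx⟩ :=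
    E.walkA.split_first (G.Adj p) E.adj_pa hpa'
  have hpy := hP y hA₁.last_mem
  -- Otherwise `p u q` could be inserted just before `y`, the old places of `p` and `q` being
  -- bridged by `b'a` and `a'b`. The two claims after this one likewise insert `p u` before `y` and
  -- between `y` and `x`.
  have hyq : ¬ (LocalizedHamiltonian.addClique G H).Adj q y := by
    intro h
    rcases hA₁.eq_single_or_concat with ⟨hA, rfl⟩ | ⟨m, c, rfl, hm, hcy⟩
    · exact E.not_adj_of_adj S hab h
    · refine E.no_longer S (Q' := [u]) (l := [u] ++ ([q] ++ ([y] ++ (A₂ ++ (B ++ (m ++ [p]))))))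
        ((WalkList.single _ u).append (hle E.adj_sq) ((WalkList.single _ q).append h
          ((WalkList.single _ y).append (hle hyx) ((hA₂.addClique H).append hab
            ((E.walkB.addClique H).append hba ((hm.addClique H).append
              (hle (hP c (by simp [hm.last_mem])).symm) (WalkList.single _ p)))))))
        (hle E.adj_pr) (by simp) (by simp) ?_
      refine List.perm_iff_count.2 fun v => ?_
      simp only [List.count_append, List.count_cons, List.count_nil]
      omega
  have hyu : ¬ G.Adj u y := by
    intro h
    rcases hA₁.eq_single_or_concat with ⟨hA, rfl⟩ | ⟨m, c, rfl, hm, hcy⟩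
    · exact E.not_adj_head S (hle h)
    · refine E.no_longer S (Q' := [u]) (l := [u] ++ ([y] ++ (A₂ ++ ([q] ++ (B ++ (m ++ [p]))))))
        ((WalkList.single _ u).append (hle h) ((WalkList.single _ y).append (hle hyx)
          ((hA₂.addClique H).append (hle E.adj_aq) ((WalkList.single _ q).append (hle E.adj_qb)
            ((E.walkB.addClique H).append hba ((hm.addClique H).append
              (hle (hP c (by simp [hm.last_mem])).symm) (WalkList.single _ p)))))))
        (hle E.adj_pr) (by simp) (by simp) ?_
      refine List.perm_iff_count.2 fun v => ?_
      simp only [List.count_append, List.count_cons, List.count_nil]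
      omega
  have hxu : ¬ G.Adj u x := by
    intro h
    refine E.no_longer S (Q' := [u]) (l := [u] ++ (A₂ ++ ([q] ++ (B ++ (A₁ ++ [p])))))
      ((WalkList.single _ u).append (hle h) ((hA₂.addClique H).append (hle E.adj_aq)
        ((WalkList.single _ q).append (hle E.adj_qb) ((E.walkB.addClique H).append hba
          ((hA₁.addClique H).append (hle hpy.symm) (WalkList.single _ p))))))
      (hle E.adj_pr) (by simp) (by simp) ?_
    refine List.perm_iff_count.2 fun v => ?_
    simp only [List.count_append, List.count_cons, List.count_nil]
    omega
  have hu : u ∉ H := E.not_heavy (by simp)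
  have hyb : (LocalizedHamiltonian.addClique G H).Adj y b' := by
    refine adj_of_claw S E.adj_pr hpy E.adj_bp.symm hyu (fun h => E.rev.not_adj_head S (hle h))
      (E.ne_of_mem (by simp) (by simp [hA₁.last_mem]))
      (E.ne_of_mem (by simp) (by simp [E.walkB.last_mem])) ?_ hu
    rintro rfl
    have h := E.nodup.of_append_right
    simp only [List.nodup_cons, List.nodup_append] at h
    exact h.2.2.2.2 _ (by simp [hA₁.last_mem]) _ E.walkB.last_mem rfl
  have hxq : ¬ (LocalizedHamiltonian.addClique G H).Adj x q := by
    intro h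
    refine E.no_longer S (Q' := [u])
      (l := [u] ++ ([p] ++ (A₁ ++ (B.reverse ++ (A₂.reverse ++ [q])))))
      ((WalkList.single _ u).append (hle E.adj_pr.symm) ((WalkList.single _ p).append
        (hle E.adj_pa) ((hA₁.addClique H).append hyb ((E.walkB.addClique H).reverse.append hab.symm
          ((hA₂.addClique H).reverse.append h (WalkList.single _ q))))))
      (hle E.adj_sq.symm) (by simp) (by simp) ?_
    refine List.perm_iff_count.2 fun v => ?_
    simp only [List.count_append, List.count_cons, List.count_nil, List.count_reverse]
    omega
  have hZ := S.Z₂ u q p y x E.adj_sq E.adj_pr.symm hpq.symm hpy hyx hyu hxu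
    (fun h => hyq (hle h)) (fun h => hxq (hle h.symm)) hx
  have hy : y ∈ H := hZ.1.resolve_right fun h => hu h.1
  refine ⟨A₁, A₂, y, x, rfl, hA₁, hA₂, hpy.symm, fun hq => hyq (Or.inr ⟨?_, hq, hy⟩), hZ.2⟩
  rintro rfl
  have h := E.nodup.of_append_right
  simp only [List.nodup_cons] at h
  exact h.2.1 (by simp [hA₁.last_mem])

/-- The stretch from `p` shows `q ∉ H` and the one from `q` shows `p ∉ H`, so both first
non-neighbours `x` and `w` lie in `H`. The clique edge `xw` replaces the edges at which the two
stretches end. -/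
theorem false_of_single (E : Ear G H n u u p q a a' b b' [u] A B) (S : Extremal G H n) :
    False := by
  have hle := le_addClique G H
  have hab := E.swap.adj_pred_succ S
  have hba := E.adj_pred_succ S
  obtain ⟨A₁, A₂, y, x, rfl, hA₁, hA₂, hyp, hq, hpx⟩ := E.exists_stretch S
  have E' : Ear G H n u u q p b b' a a' [u] B (A₁ ++ A₂) := E.swap
  obtain ⟨B₁, B₂, z, w, rfl, hB₁, hB₂, hzq, hp, hqw⟩ := E'.exists_stretch S
  have hx := hpx.resolve_left hp
  have hw := hqw.resolve_left hq
  have hxw : (LocalizedHamiltonian.addClique G H).Adj x w := by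
    refine Or.inr ⟨?_, hx, hw⟩
    rintro rfl
    have h := E.nodup.of_append_right
    simp only [List.nodup_cons] at h
    exact (List.disjoint_of_nodup_append h.2.2) (List.mem_append_right _ hA₂.head_mem)
      (List.mem_append_right _ hB₂.head_mem)
  refine E.no_longer S (Q' := [u])
    (l := [u] ++ ([q] ++ (B₁.reverse ++ (A₂.reverse ++ (B₂ ++ (A₁ ++ [p]))))))
    ((WalkList.single _ u).append (hle E.adj_sq) ((WalkList.single _ q).append (hle hzq.symm)
      ((hB₁.addClique H).reverse.append hab.symm ((hA₂.addClique H).reverse.append hxw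
        ((hB₂.addClique H).append hba ((hA₁.addClique H).append (hle hyp)
          (WalkList.single _ p)))))))
    (hle E.adj_pr) (by simp) (by simp) ?_
  refine List.perm_iff_count.2 fun v => ?_
  simp only [List.count_append, List.count_cons, List.count_nil, List.count_reverse]
  omega

end Ear

end

/-! ### Cycles through heavy vertices: Ore's argument -/

section

variable {V : Type*}

/-- The list `l` enumerates, in cyclic order, the vertices of a cycle of `K`. -/
structure IsCycleList (K : SimpleGraph V) (l : List V) : Prop where
  nodup : l.Nodup
  three_le : 3 ≤ l.length
  closed : ∃ c d, WalkList K c l d ∧ K.Adj d c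

theorem exists_of_not_isChain {R : V → V → Prop} : ∀ {l : List V}, ¬ l.IsChain R →
    ∃ l₁ c d l₂, l = (l₁ ++ [c]) ++ (d :: l₂) ∧ ¬ R c d
  | [], h => (h List.IsChain.nil).elim
  | [_], h => (h (List.IsChain.singleton _)).elim
  | a :: b :: t, h => by
    by_cases hab : R a b
    · obtain ⟨l₁, c, d, l₂, hl, hcd⟩ := exists_of_not_isChain (l := b :: t)
        fun h' => h (List.isChain_cons_cons.2 ⟨hab, h'⟩)
      exact ⟨a :: l₁, c, d, l₂, by rw [hl]; rfl, hcd⟩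
    · exact ⟨[], a, b, t, rfl, hab⟩

namespace IsCycleList

variable {K K' : SimpleGraph V} {l : List V}

theorem mono (h : IsCycleList K l) (hK : K ≤ K') : IsCycleList K' l :=
  let ⟨c, d, hw, hdc⟩ := h.closed
  ⟨h.nodup, h.three_le, c, d, hw.mono fun _ _ _ _ hxy => hK hxy, hK hdc⟩

/-- A cycle in `K'` is a cycle in `K` or can be rotated so that its closing edge is not in `K`. -/
theorem mono_or_exists_not_adj (h : IsCycleList K' l) (K : SimpleGraph V) :
    IsCycleList K l ∨ ∃ l' c d, l'.Perm l ∧ WalkList K' c l' d ∧ K'.Adj d c ∧ ¬ K.Adj d c := by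
  obtain ⟨c, d, hw, hdc⟩ := h.closed
  by_cases hK : K.Adj d c
  · by_cases hch : l.IsChain K.Adj
    · exact Or.inl ⟨h.nodup, h.three_le, c, d, ⟨hch, hw.head, hw.last⟩, hK⟩
    · obtain ⟨l₁, e, f, l₂, rfl, hef⟩ := exists_of_not_isChain hch
      obtain ⟨e', f', h1, hef', h2⟩ := hw.split (by simp) (by simp)
      have he : e = e' := by simpa using h1.last
      have hf : f = f' := by simpa using h2.head
      subst he hf
      exact Or.inr ⟨_, f, e, List.perm_append_comm, h2.append hdc h1, hef', hef⟩
  · exact Or.inr ⟨l, c, d, List.Perm.refl l, hw, hdc, hK⟩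

end IsCycleList

theorem WalkList.ne_of_nodup {K : SimpleGraph V} {a b : V} {l : List V} (h : WalkList K a l b)
    (hl : l.Nodup) (hlen : 2 ≤ l.length) : a ≠ b := by
  rintro rfl
  rcases h.eq_single_or_concat with ⟨rfl, -⟩ | ⟨m, c, rfl, hm, -⟩
  · simp at hlen
  · exact (List.disjoint_of_nodup_append hl) hm.head_mem (by simp)

/-- If `P` and `Q` never hold at `w` and `v` for consecutive entries `v`, `w`, then `P` and `Q`
together hold rarely. -/
theorem countP_add_countP_le (P Q : V → Bool) : ∀ (a : V) (t : List V),
    (∀ l₁ v w l₂, a :: t = l₁ ++ v :: w :: l₂ → ¬ (Q v ∧ P w)) →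
    t.countP P + (a :: t).dropLast.countP Q ≤ t.length
  | a, [], _ => by simp
  | a, b :: t, h => by
    have ih := countP_add_countP_le P Q b t fun l₁ v w l₂ hl =>
      h (a :: l₁) v w l₂ (by rw [hl]; rfl)
    have h0 := h [] a b t rfl
    rw [List.dropLast_cons_cons, List.countP_cons, List.countP_cons, List.length_cons]
    by_cases hP : P b <;> by_cases hQ : Q a <;> simp_all <;> omega

variable [Fintype V] [DecidableEq V]

theorem countP_adj_eq (G : SimpleGraph V) [DecidableRel G.Adj] (x : V) {l : List V}
    (hl : l.Nodup) : l.countP (fun v => decide (G.Adj x v)) =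
      (G.neighborFinset x ∩ l.toFinset).card := by
  rw [List.countP_eq_length_filter, ← List.toFinset_card_of_nodup (hl.filter _)]
  congr 1
  ext v
  simp [and_comm]

/-- The vertices of a path with heavy ends lie on a cycle. -/
theorem exists_cycle_of_walk {G G₁ : SimpleGraph V} [DecidableRel G.Adj] (hG : G ≤ G₁) {x y : V}
    (hxy : Fintype.card V ≤ G.degree x + G.degree y) {l : List V}
    (h : WalkList G₁ x l y) (hl : l.Nodup) (hlen : 3 ≤ l.length) :
    ∃ l', IsCycleList G₁ l' ∧ l ⊆ l' := by
  by_contra hno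
  have hw : ∀ w, w ∉ l → ¬ (G.Adj x w ∧ G.Adj y w) := by
    rintro w hwl ⟨hxw, hyw⟩
    refine hno ⟨l ++ [w], ⟨?_, by simp; omega, x, w, h.append (hG hyw) (WalkList.single _ w),
      hG hxw.symm⟩, List.subset_append_left _ _⟩
    rw [List.nodup_append]
    refine ⟨hl, by simp, fun a ha b hb => ?_⟩
    rw [List.mem_singleton] at hb
    subst hb
    rintro rfl
    exact hwl ha
  -- A crossing pair of edges `yv`, `xw` would turn the path into a cycle on the same vertices.
  have hcross : ∀ l₁ v w l₂, l = l₁ ++ v :: w :: l₂ → ¬ (G.Adj y v ∧ G.Adj x w) := by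
    rintro l₁ v w l₂ rfl ⟨hyv, hxw⟩
    have h' : WalkList G₁ x ((l₁ ++ [v]) ++ (w :: l₂)) y := by simpa using h
    obtain ⟨v', w', h1, -, h2⟩ := h'.split (by simp) (by simp)
    have hv : v = v' := by simpa using h1.last
    have hw : w = w' := by simpa using h2.head
    subst hv hw
    have hp : ((l₁ ++ [v]) ++ (w :: l₂).reverse).Perm (l₁ ++ v :: w :: l₂) := by
      refine List.perm_iff_count.2 fun v => ?_
      simp only [List.count_append, List.count_cons, List.count_nil, List.count_reverse]
      omega
    exact hno ⟨_, ⟨hp.nodup_iff.2 hl, hp.length_eq ▸ hlen, x, w,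
      h1.append (hG hyv.symm) h2.reverse, hG hxw.symm⟩, hp.symm.subset⟩
  obtain ⟨t, rfl⟩ : ∃ t, l = x :: t := by
    cases l with
    | nil => simp at hlen
    | cons a t => exact ⟨t, by simpa using h.head⟩
  -- On the path the two degrees sum to at most `|l| - 1`, as no crossing pair exists; off it the
  -- neighbourhoods are disjoint. The total is below `|V|`, a contradiction.
  have hc := countP_add_countP_le (fun v => decide (G.Adj x v)) (fun v => decide (G.Adj y v)) x t
    (by simpa using hcross)
  have h1 : t.countP (fun v => decide (G.Adj x v)) =
      (x :: t).countP (fun v => decide (G.Adj x v)) := by simp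
  have h2 : (x :: t).dropLast.countP (fun v => decide (G.Adj y v)) =
      (x :: t).countP (fun v => decide (G.Adj y v)) := by
    obtain ⟨m, hm⟩ := List.getLast?_eq_some_iff.1 h.last
    rw [hm, List.dropLast_concat]
    simp
  rw [h1, h2, countP_adj_eq G x hl, countP_adj_eq G y hl] at hc
  set L := (x :: t).toFinset with hL
  have hLc : L.card = t.length + 1 := by
    rw [hL, List.toFinset_card_of_nodup hl, List.length_cons]
  have hd : Disjoint (G.neighborFinset x \ L) (G.neighborFinset y \ L) := by
    rw [Finset.disjoint_left]
    intro w hwx hwy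
    rw [Finset.mem_sdiff, mem_neighborFinset, hL, List.mem_toFinset] at hwx hwy
    exact hw w hwx.2 ⟨hwx.1, hwy.1⟩
  have hsub : (G.neighborFinset x \ L) ∪ (G.neighborFinset y \ L) ⊆ Lᶜ := by
    intro w
    simp only [Finset.mem_union, Finset.mem_sdiff, Finset.mem_compl]
    tauto
  have h3 := Finset.card_le_card hsub
  rw [Finset.card_union_of_disjoint hd, Finset.card_compl] at h3
  have h4 := Finset.card_sdiff_add_card_inter (G.neighborFinset x) L
  have h5 := Finset.card_sdiff_add_card_inter (G.neighborFinset y) L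
  rw [card_neighborFinset_eq_degree] at h4 h5
  have h6 : L.card ≤ Fintype.card V := Finset.card_le_univ _
  omega

/-- An edge between heavy vertices can be removed without losing cycles. -/
theorem exists_cycle_of_sup_edge {G G₁ K : SimpleGraph V} [DecidableRel G.Adj] (hG : G ≤ G₁)
    {e : Sym2 V} (he : ∀ v ∈ e, Fintype.card V ≤ 2 * G.degree v)
    (hK : ∀ v w, K.Adj v w → G₁.Adj v w ∨ s(v, w) = e) {l : List V} (h : IsCycleList K l) :
    ∃ l', IsCycleList G₁ l' ∧ l ⊆ l' := by
  rcases h.mono_or_exists_not_adj G₁ with h' | ⟨m, c, d, hp, hw, hdc, hn⟩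
  · exact ⟨l, h', fun _ => id⟩
  · have hm : m.Nodup := hp.nodup_iff.2 h.nodup
    have hlen : 3 ≤ m.length := hp.length_eq ▸ h.three_le
    have hdce : s(d, c) = e := (hK d c hdc).resolve_left hn
    -- Once `e` is the closing edge, the rest of the cycle avoids it: using `e` again would repeat
    -- an endpoint or force the path to have only two vertices.
    have hw' : WalkList G₁ c m d := by
      rcases hw.eq_single_or_concat with ⟨rfl, -⟩ | ⟨m, f, rfl, hmf, hfd⟩
      · simp at hlen
      have hdm : d ∉ m := fun hd => (List.disjoint_of_nodup_append hm) hd (by simp)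
      have hcf : c ≠ f := hmf.ne_of_nodup hm.of_append_left (by simp at hlen; omega)
      refine (hmf.mono fun v hv w hw hvw => (hK v w hvw).resolve_right ?_).append
        ((hK f d hfd).resolve_right ?_) (WalkList.single _ d)
      · rw [← hdce, Sym2.eq_iff]
        rintro (⟨rfl, -⟩ | ⟨-, rfl⟩) <;> contradiction
      · rw [← hdce, Sym2.eq_iff]
        rintro (⟨rfl, rfl⟩ | ⟨rfl, -⟩)
        · exact hdm hmf.last_mem
        · exact hcf rfl
    have hc := he c (by simp [← hdce])
    have hd := he d (by simp [← hdce])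
    obtain ⟨l', hl', hs⟩ := exists_cycle_of_walk hG (by omega) hw' hm hlen
    exact ⟨l', hl', fun _ hv => hs (hp.symm.subset hv)⟩

/-- The vertices of a cycle in the graph in which the heavy vertices are made a clique lie on a
cycle of `G`. -/
theorem exists_cycle_of_addClique {G : SimpleGraph V} [DecidableRel G.Adj] {H : Set V}
    (hH : ∀ v ∈ H, Fintype.card V ≤ 2 * G.degree v) {l : List V}
    (h : IsCycleList (addClique G H) l) : ∃ l', IsCycleList G l' ∧ l ⊆ l' := by
  classical
  -- The clique edges are removed one at a time. Heaviness always refers to degrees in `G`, so it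
  -- survives each removal.
  have key : ∀ s : Finset (Sym2 V), (∀ e ∈ s, ∀ v ∈ e, v ∈ H) → ∀ l,
      IsCycleList (G ⊔ fromEdgeSet (s : Set (Sym2 V))) l → ∃ l', IsCycleList G l' ∧ l ⊆ l' := by
    intro s
    induction s using Finset.induction_on with
    | empty => exact fun _ l hl => ⟨l, hl.mono (by simp), fun _ => id⟩
    | insert e s _ ih =>
      intro hs l hl
      obtain ⟨l₁, hl₁, hsub₁⟩ := exists_cycle_of_sup_edge (G := G) (e := e)
        (G₁ := G ⊔ fromEdgeSet (s : Set (Sym2 V))) le_sup_left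
        (fun v hv => hH v (hs e (Finset.mem_insert_self e s) v hv))
        (fun v w hvw => by
          simp only [sup_adj, fromEdgeSet_adj, Finset.coe_insert, Set.mem_insert_iff] at hvw ⊢
          tauto) hl
      obtain ⟨l₂, hl₂, hsub₂⟩ := ih (fun f hf => hs f (Finset.mem_insert_of_mem hf)) l₁ hl₁
      exact ⟨l₂, hl₂, fun _ hv => hsub₂ (hsub₁ hv)⟩
  refine key (Finset.univ.filter fun e => ∀ v ∈ e, v ∈ H) (by simp) l (h.mono ?_)
  rintro v w (hvw | ⟨hne, hv, hw⟩)
  · exact Or.inl hvw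
  · refine Or.inr ?_
    simp [fromEdgeSet_adj, hne, hv, hw]

end

/-! ### From vertex lists to walks and Hamiltonian cycles -/

section

variable {V : Type*}

namespace WalkList

variable {K : SimpleGraph V} {a b : V} {l : List V}

theorem of_walk (p : K.Walk a b) : WalkList K a p.support b where
  chain := p.isChain_adj_support
  head := by rw [List.head?_eq_some_head p.support_ne_nil, Walk.head_support]
  last := by rw [List.getLast?_eq_some_getLast p.support_ne_nil, Walk.getLast_support]

theorem of_walk_induce {T : Set V} {a b : T} (p : (K.induce T).Walk a b) :
    WalkList K a (p.support.map Subtype.val) b := by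
  have h := of_walk (p.map (Embedding.induce T).toHom)
  rwa [Walk.support_map] at h

theorem exists_walk (h : WalkList K a l b) : ∃ p : K.Walk a b, p.support = l := by
  have ha : l.head h.ne_nil = a := by
    have := h.head
    rwa [List.head?_eq_some_head h.ne_nil, Option.some.injEq] at this
  have hb : l.getLast h.ne_nil = b := by
    have := h.last
    rwa [List.getLast?_eq_some_getLast h.ne_nil, Option.some.injEq] at this
  exact ⟨(Walk.ofSupport l h.ne_nil h.chain).copy ha hb, by simp⟩

end WalkList

namespace IsCycleList

variable {K : SimpleGraph V} {l : List V}

theorem exists_rotation (h : IsCycleList K l) {p : V} (hp : p ∈ l) :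
    ∃ t e, (p :: t).Perm l ∧ WalkList K p (p :: t) e ∧ K.Adj e p := by
  obtain ⟨c, d, hw, hdc⟩ := h.closed
  obtain ⟨l₁, l₂, rfl⟩ := List.append_of_mem hp
  by_cases hl : l₁ = []
  · subst hl
    obtain rfl : p = c := by simpa using hw.head
    exact ⟨l₂, d, List.Perm.refl _, hw, hdc⟩
  · obtain ⟨e, f, h1, hef, h2⟩ := hw.split hl (by simp)
    obtain rfl : p = f := by simpa using h2.head
    exact ⟨l₂ ++ l₁, e, List.perm_append_comm (l₁ := p :: l₂), h2.append hdc h1, hef⟩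

theorem isHamiltonian [Fintype V] [DecidableEq V] (h : IsCycleList K l) (hl : ∀ v, v ∈ l) :
    K.IsHamiltonian := by
  intro _
  obtain ⟨c, d, hw, hdc⟩ := h.closed
  obtain ⟨p, hp⟩ := hw.exists_walk
  have hpath : p.IsPath := Walk.IsPath.mk' (hp ▸ h.nodup)
  refine ⟨d, Walk.cons hdc p, ?_⟩
  rw [Walk.isHamiltonianCycle_isCycle_and_isHamiltonian_tail]
  constructor
  · refine (Walk.cons_isCycle_iff p hdc).2 ⟨hpath, fun he => ?_⟩
    have h1 := hpath.length_eq_one_of_mem_edges (Sym2.eq_swap ▸ he)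
    have h2 := p.length_support
    have h3 := h.three_le
    rw [hp, h1] at h2
    omega
  · have : (Walk.cons hdc p).tail.IsPath := by simpa using hpath
    refine this.isHamiltonian_of_mem fun w => ?_
    simpa [hp] using hl w

end IsCycleList

/-! ### Heavy vertices in induced claws and copies of `Z₂` -/

section Heavy

variable [Fintype V]

/-- The vertices of degree at least half the order of the graph. -/
def heavySet (G : SimpleGraph V) [DecidableRel G.Adj] : Set V :=
  {v | Fintype.card V ≤ 2 * G.degree v}

theorem LocalizedCondition.mem_heavySet {G : SimpleGraph V} [DecidableRel G.Adj] {W : Type*}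
    {F : SimpleGraph W} (f : F ↪g G) (h : LocalizedCondition G (Set.range f) 2) {i j k : W}
    (hik : F.Adj i k) (hkj : F.Adj k j) (hij : i ≠ j) (hn : ¬ F.Adj i j) :
    f i ∈ heavySet G ∨ f j ∈ heavySet G := by
  have h2 := h ⟨f i, i, rfl⟩ ⟨f j, j, rfl⟩ (by
    have : (G.induce (Set.range f)).edist ⟨f i, i, rfl⟩ ⟨f j, j, rfl⟩ = 2 := by
      rw [edist_eq_two_iff]
      refine ⟨fun h => hij (f.injective (Subtype.ext_iff.1 h)), fun h => hn (f.map_adj_iff.1 h),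
        ⟨f k, k, rfl⟩, ?_⟩
      rw [mem_commonNeighbors]
      exact ⟨f.map_adj_iff.2 hik, f.map_adj_iff.2 hkj.symm⟩
    exact_mod_cast this)
  rw [le_max_iff] at h2
  refine h2.imp (fun h => ?_) fun h => ?_ <;>
  · rw [div_le_iff₀ (by norm_num)] at h
    rw [heavySet, Set.mem_ofPred_eq, mul_comm]
    exact_mod_cast h

/-- Any two leaves of a claw are at distance two, so at most one leaf is light. -/
theorem claw_heavy {G : SimpleGraph V} [DecidableRel G.Adj]
    (h : ∀ S : Set V, Nonempty (G.induce S ≃g claw) → LocalizedCondition G S 2)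
    {c x y z : V} (hx : G.Adj c x) (hy : G.Adj c y) (hz : G.Adj c z) (hxy : x ≠ y) (hxz : x ≠ z)
    (hyz : y ≠ z) (hxy' : ¬ G.Adj x y) (hxz' : ¬ G.Adj x z) (hyz' : ¬ G.Adj y z)
    (hH : x ∉ heavySet G) : y ∈ heavySet G ∧ z ∈ heavySet G := by
  have hinj : Function.Injective (Sum.elim (fun _ : Fin 1 => c) ![x, y, z]) := by
    have h1 : ∀ i : Fin 3, c ≠ ![x, y, z] i := by
      simp [Fin.forall_fin_succ, hx.ne, hy.ne, hz.ne]
    have h2 : ∀ i j : Fin 3, ![x, y, z] i = ![x, y, z] j → i = j := by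
      simp [Fin.forall_fin_succ, hxy, hxz, hyz, hxy.symm, hxz.symm, hyz.symm]
    rintro (i | i) (j | j) hij
    · rw [Subsingleton.elim i j]
    · exact (h1 j hij).elim
    · exact (h1 i hij.symm).elim
    · rw [h2 i j hij]
  have hadj : ∀ i j, G.Adj (Sum.elim (fun _ : Fin 1 => c) ![x, y, z] i)
      (Sum.elim (fun _ : Fin 1 => c) ![x, y, z] j) ↔ claw.Adj i j := by
    have h1 : ∀ i : Fin 3, G.Adj c (![x, y, z] i) := by simp [Fin.forall_fin_succ, hx, hy, hz]
    have h2 : ∀ i j : Fin 3, ¬ G.Adj (![x, y, z] i) (![x, y, z] j) := by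
      have hyx' : ¬ G.Adj y x := fun h => hxy' h.symm
      have hzx' : ¬ G.Adj z x := fun h => hxz' h.symm
      have hzy' : ¬ G.Adj z y := fun h => hyz' h.symm
      simp [Fin.forall_fin_succ, hxy', hxz', hyz', hyx', hzx', hzy']
    rintro (i | i) (j | j)
    · simp
    · simpa using h1 j
    · simpa using (h1 i).symm
    · simpa using h2 i j
  let f : claw ↪g G := ⟨⟨_, hinj⟩, hadj _ _⟩
  have hS := h (Set.range f) ⟨f.isoInduceRange.symm⟩
  have key : ∀ i j : Fin 3, i ≠ j → f (.inr i) ∈ heavySet G ∨ f (.inr j) ∈ heavySet G :=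
    fun i j hij => LocalizedCondition.mem_heavySet f hS (k := .inl 0) (by simp) (by simp)
      (by simpa using hij) (by simp)
  exact ⟨(key 0 1 (by decide)).resolve_left hH, (key 0 2 (by decide)).resolve_left hH⟩

/-- The pairs at distance two in `Z₂` are `a, d`, then `b, d`, and `c, e`. -/
theorem Z₂_heavy {G : SimpleGraph V} [DecidableRel G.Adj]
    (h : ∀ S : Set V, Nonempty (G.induce S ≃g Z₂) → LocalizedCondition G S 2)
    {a b c d e : V} (hab : G.Adj a b) (hac : G.Adj a c) (hbc : G.Adj b c) (hcd : G.Adj c d)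
    (hde : G.Adj d e) (had : ¬ G.Adj a d) (hae : ¬ G.Adj a e) (hbd : ¬ G.Adj b d)
    (hbe : ¬ G.Adj b e) (hce : ¬ G.Adj c e) :
    (d ∈ heavySet G ∨ a ∈ heavySet G ∧ b ∈ heavySet G) ∧
      (c ∈ heavySet G ∨ e ∈ heavySet G) := by
  have hne : ∀ {u v w : V}, G.Adj u w → ¬ G.Adj v w → u ≠ v := by
    rintro u v w h1 h2 rfl
    exact h2 h1
  have n1 := hab.ne
  have n2 := hac.ne
  have n3 := hbc.ne
  have n4 := hcd.ne
  have n5 := hde.ne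
  have n6 : a ≠ d := (hne hde hae).symm
  have n7 : b ≠ d := (hne hde hbe).symm
  have n8 : c ≠ e := (hne hac.symm fun h => hae h.symm)
  have n9 : a ≠ e := hne hac fun h => hce h.symm
  have n10 : b ≠ e := hne hbc fun h => hce h.symm
  have hinj : Function.Injective ![a, b, c, d, e] := by
    have : ∀ i j : Fin 5, ![a, b, c, d, e] i = ![a, b, c, d, e] j → i = j := by
      simp [Fin.forall_fin_succ, n1, n2, n3, n4, n5, n6, n7, n8, n9, n10, n1.symm, n2.symm,
        n3.symm, n4.symm, n5.symm, n6.symm, n7.symm, n8.symm, n9.symm, n10.symm]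
    exact fun i j => this i j
  have hadj : ∀ i j, G.Adj (![a, b, c, d, e] i) (![a, b, c, d, e] j) ↔ Z₂.Adj i j := by
    have had' : ¬ G.Adj d a := fun h => had h.symm
    have hae' : ¬ G.Adj e a := fun h => hae h.symm
    have hbd' : ¬ G.Adj d b := fun h => hbd h.symm
    have hbe' : ¬ G.Adj e b := fun h => hbe h.symm
    have hce' : ¬ G.Adj e c := fun h => hce h.symm
    simp [Fin.forall_fin_succ, Z₂, hab, hac, hbc, hcd, hde, hab.symm, hac.symm, hbc.symm,
      hcd.symm, hde.symm, had, hae, hbd, hbe, hce, had', hae', hbd', hbe', hce']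
  let f : Z₂ ↪g G := ⟨⟨_, hinj⟩, hadj _ _⟩
  have hS := h (Set.range f) ⟨f.isoInduceRange.symm⟩
  have h1 : a ∈ heavySet G ∨ d ∈ heavySet G :=
    LocalizedCondition.mem_heavySet f hS (i := 0) (j := 3) (k := 2) (by simp [Z₂]) (by simp [Z₂])
      (by decide) (by simp [Z₂])
  have h2 : b ∈ heavySet G ∨ d ∈ heavySet G :=
    LocalizedCondition.mem_heavySet f hS (i := 1) (j := 3) (k := 2) (by simp [Z₂]) (by simp [Z₂])
      (by decide) (by simp [Z₂])
  have h3 : c ∈ heavySet G ∨ e ∈ heavySet G :=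
    LocalizedCondition.mem_heavySet f hS (i := 2) (j := 4) (k := 3) (by simp [Z₂]) (by simp [Z₂])
      (by decide) (by simp [Z₂])
  tauto

end Heavy

end

/-! ### Cycles and ears from 2-connectedness -/

section

variable {V : Type*} [Fintype V]

namespace IsKConnected

variable {G : SimpleGraph V}

theorem exists_path_avoiding (hG : IsKConnected G 2) {S : Finset V} (hS : S.card < 2) {u v : V}
    (hu : u ∉ S) (hv : v ∉ S) : ∃ l, WalkList G u l v ∧ l.Nodup ∧ ∀ w ∈ l, w ∉ S := by
  obtain ⟨p, hp⟩ := (hG.2 S hS).exists_isPath ⟨u, hu⟩ ⟨v, hv⟩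
  refine ⟨_, WalkList.of_walk_induce p, hp.support_nodup.map Subtype.val_injective, ?_⟩
  simp only [List.mem_map]
  rintro w ⟨w', -, rfl⟩
  exact w'.2

theorem exists_adj_ne [DecidableEq V] (hG : IsKConnected G 2) {v x : V} (hvx : v ≠ x) :
    ∃ w, G.Adj v w ∧ w ≠ x := by
  obtain ⟨y, hy⟩ : ∃ y, y ∉ ({v, x} : Finset V) := by
    by_contra! h
    have h1 := Finset.card_le_card (fun y _ => h y : (Finset.univ : Finset V) ⊆ {v, x})
    have h2 := (Finset.card_le_two : ({v, x} : Finset V).card ≤ 2)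
    have := hG.1
    rw [Finset.card_univ] at h1
    omega
  simp only [Finset.mem_insert, Finset.mem_singleton, not_or] at hy
  obtain ⟨l, hl, -, hlx⟩ := hG.exists_path_avoiding (S := {x}) (by simp) (u := v) (v := y)
    (by simpa using hvx) (by simpa using hy.2)
  obtain ⟨t, rfl⟩ : ∃ t, l = v :: t := by
    cases l with
    | nil => simpa using hl.head
    | cons a t => exact ⟨t, by simpa using hl.head⟩
  cases t with
  | nil => exact (hy.1 (by simpa using hl.last.symm)).elim
  | cons w t =>
    exact ⟨w, (List.isChain_cons_cons.1 hl.chain).1, by simpa using hlx w (by simp)⟩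

/-- Every set of vertices lies on a cycle once it is made a clique. -/
theorem exists_cycle_addClique [DecidableEq V] (hG : IsKConnected G 2) (H : Set V) :
    ∃ l, IsCycleList (addClique G H) l ∧ ∀ h ∈ H, h ∈ l := by
  classical
  -- Three or more vertices of `H` form a cycle in any order. Otherwise `H` lies in the ends of an
  -- edge `xy`, and a path avoiding `x` from another neighbour of `x` to `y` completes a cycle.
  by_cases hcard : 3 ≤ H.toFinset.card
  · have hlen : 3 ≤ H.toFinset.toList.length := by simpa using hcard
    have hne : H.toFinset.toList ≠ [] := by
      intro h
      simp [h] at hlen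
    have hpw : H.toFinset.toList.Pairwise (addClique G H).Adj := by
      refine List.Pairwise.imp_of_mem ?_ H.toFinset.nodup_toList
      intro a b ha hb hab
      exact Or.inr ⟨hab, by simpa using ha, by simpa using hb⟩
    obtain ⟨c, d, hcd⟩ := WalkList.exists_of_ne_nil hpw.isChain hne
    have hne' : c ≠ d := hcd.ne_of_nodup H.toFinset.nodup_toList (by omega)
    exact ⟨_, ⟨H.toFinset.nodup_toList, hlen, c, d, hcd,
      Or.inr ⟨hne'.symm, by simpa using hcd.last_mem, by simpa using hcd.head_mem⟩⟩, by simp⟩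
  · have hpair : ∃ x y, (addClique G H).Adj x y ∧ ∀ h ∈ H, h = x ∨ h = y := by
      have hv : ∀ v : V, ∃ w, G.Adj v w := fun v => by
        obtain ⟨x, hx⟩ := Fintype.exists_ne_of_one_lt_card (lt_trans one_lt_two hG.1) v
        exact (hG.exists_adj_ne hx.symm).imp fun w hw => hw.1
      rcases Nat.lt_or_ge H.toFinset.card 2 with h2 | h2
      · obtain ⟨x, hx⟩ : ∃ x, ∀ h ∈ H, h = x := by
          rcases H.eq_empty_or_nonempty with rfl | ⟨x, hx⟩
          · have : 0 < Fintype.card V := lt_trans two_pos hG.1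
            obtain ⟨x⟩ := Fintype.card_pos_iff.1 this
            exact ⟨x, by simp⟩
          · exact ⟨x, fun h hh => Finset.card_le_one.1 (Nat.lt_succ_iff.1 h2) h (by simpa using hh)
              x (by simpa using hx)⟩
        obtain ⟨y, hy⟩ := hv x
        exact ⟨x, y, Or.inl hy, fun h hh => Or.inl (hx h hh)⟩
      · obtain ⟨x, y, hxy, hH⟩ := Finset.card_eq_two.1 (show H.toFinset.card = 2 by omega)
        have hmem : ∀ h, h ∈ H ↔ h = x ∨ h = y := fun h => by
          rw [← Set.mem_toFinset, hH]
          simp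
        exact ⟨x, y, Or.inr ⟨hxy, (hmem x).2 (Or.inl rfl), (hmem y).2 (Or.inr rfl)⟩,
          fun h hh => (hmem h).1 hh⟩
    obtain ⟨x, y, hxy, hH⟩ := hpair
    obtain ⟨w, hxw, hwy⟩ := hG.exists_adj_ne hxy.ne
    obtain ⟨l, hl, hnd, hlx⟩ := hG.exists_path_avoiding (S := {x}) (by simp) (u := w) (v := y)
      (by simpa using hxw.ne') (by simpa using hxy.ne')
    simp only [Finset.mem_singleton] at hlx
    refine ⟨x :: l, ⟨List.nodup_cons.2 ⟨fun h => hlx x h rfl, hnd⟩, ?_, x, y,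
      (hl.addClique H).cons (Or.inl hxw), hxy.symm⟩, ?_⟩
    · rcases hl.eq_single_or_concat with ⟨-, h⟩ | ⟨m, c, rfl, hm, -⟩
      · exact (hwy h).elim
      · have := List.length_pos_of_ne_nil hm.ne_nil
        simp
        omega
    · intro h hh
      rcases hH h hh with rfl | rfl
      · simp
      · simp [hl.last_mem]

/-- From a vertex off `C` one reaches, off `C`, a neighbour of a vertex of `C \ S`. -/
theorem exists_adj_reachable (hG : IsKConnected G 2) {S : Finset V} (hS : S.card < 2)
    {C : Set V} (u : (Cᶜ : Set V)) (hu : (u : V) ∉ S) (hC : ∃ c ∈ C, c ∉ S) :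
    ∃ p ∈ C, p ∉ S ∧ ∃ r : (Cᶜ : Set V), G.Adj p r ∧ (G.induce Cᶜ).Reachable u r := by
  obtain ⟨c, hc, hcS⟩ := hC
  obtain ⟨w⟩ := (hG.2 S hS).preconnected ⟨u, hu⟩ ⟨c, hcS⟩
  -- Where a walk from `u` to `c` avoiding `S` first leaves the component of `u` off `C`, it enters
  -- `C`.
  obtain ⟨d, -, ⟨h1, h1'⟩, h2⟩ := w.exists_boundary_dart
    {x | ∃ h : (x : V) ∈ Cᶜ, (G.induce Cᶜ).Reachable u ⟨x, h⟩} ⟨u.2, Reachable.refl _⟩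
    (fun ⟨h, _⟩ => h hc)
  have hadj : G.Adj d.fst d.snd := d.adj
  have hp : (d.snd : V) ∈ C := by
    by_contra h
    refine h2 ⟨h, h1'.trans (Adj.reachable ?_)⟩
    exact hadj
  exact ⟨d.snd, hp, d.snd.2, ⟨d.fst, h1⟩, hadj.symm, h1'⟩

/-- A shortest path leading, off `C`, from one vertex of `C` to another one. -/
theorem exists_shortest_ear (hG : IsKConnected G 2) {C : Set V} {u c c' : V} (hu : u ∉ C)
    (hc : c ∈ C) (hc' : c' ∈ C) (hne : c ≠ c') :
    ∃ (p q r s : V) (Q : List V), p ∈ C ∧ q ∈ C ∧ p ≠ q ∧ WalkList G r Q s ∧ Q.Nodup ∧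
      (∀ v ∈ Q, v ∉ C) ∧ G.Adj p r ∧ G.Adj s q ∧
      ((Q = [r] ∧ r = s) ∨ ∃ w w' Q₁ Q₂, Q = r :: w :: Q₁ ∧ Q.reverse = s :: w' :: Q₂ ∧
        ¬ G.Adj p w ∧ ¬ G.Adj q w') := by
  classical
  have hex : ∃ (k : ℕ) (p q : V) (r s : (Cᶜ : Set V)) (w : (G.induce Cᶜ).Walk r s),
      p ∈ C ∧ q ∈ C ∧ p ≠ q ∧ G.Adj p r ∧ G.Adj s q ∧ w.length = k := by
    obtain ⟨p, hp, -, r, hpr, hr⟩ := hG.exists_adj_reachable (S := ∅) (by simp) ⟨u, hu⟩ (by simp)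
      ⟨c, hc, by simp⟩
    -- Deleting `p` forces a second attachment vertex.
    obtain ⟨q, hq, hqp, s, hqs, hs⟩ := hG.exists_adj_reachable (S := {p}) (by simp) ⟨u, hu⟩
      (by
        rw [Finset.mem_singleton]
        rintro rfl
        exact hu hp)
      (by
        by_cases h : c = p
        · exact ⟨c', hc', by simpa using fun h' => hne (h.trans h'.symm)⟩
        · exact ⟨c, hc, by simpa using h⟩)
    obtain ⟨w⟩ := hr.symm.trans hs
    exact ⟨_, p, q, r, s, w, hp, hq, by simpa [eq_comm] using hqp, hpr, hqs.symm, rfl⟩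
  obtain ⟨p, q, r, s, w₀, hp, hq, hpq, hpr, hsq, hk⟩ := Nat.find_spec hex
  have hmin : ∀ (p q : V) (r s : (Cᶜ : Set V)) (w : (G.induce Cᶜ).Walk r s), p ∈ C → q ∈ C →
      p ≠ q → G.Adj p r → G.Adj s q → w₀.length ≤ w.length := fun p q r s w h1 h2 h3 h4 h5 => by
    rw [hk]
    exact Nat.find_min' hex ⟨p, q, r, s, w, h1, h2, h3, h4, h5, rfl⟩
  have hpath : w₀.bypass.IsPath := w₀.bypass_isPath
  have hlen := w₀.length_bypass_le_length
  generalize w₀.bypass = w at hpath hlen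
  refine ⟨p, q, r, s, _, hp, hq, hpq, WalkList.of_walk_induce w,
    hpath.support_nodup.map Subtype.val_injective, ?_, hpr, hsq, ?_⟩
  · simp only [List.mem_map]
    rintro v ⟨v', -, rfl⟩
    exact v'.2
  -- If `p` were adjacent to the second vertex of the ear, dropping the first would give a shorter
  -- one.
  have key : ∀ {p q : V} {r s : (Cᶜ : Set V)} (w : (G.induce Cᶜ).Walk r s), p ∈ C → q ∈ C →
      p ≠ q → G.Adj s q → w.length ≤ w₀.length → (w.support.map Subtype.val = [(r : V)] ∧ r = s) ∨
      ∃ (x : V) (t : List V), w.support.map Subtype.val = (r : V) :: x :: t ∧ ¬ G.Adj p x := by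
    intro p q r s w hp hq hpq hsq hw
    cases w with
    | nil => exact Or.inl ⟨by simp, rfl⟩
    | @cons _ x _ h w' =>
      refine Or.inr ⟨x, w'.support.tail.map Subtype.val, ?_, fun hpx => ?_⟩
      · rw [Walk.support_cons, List.map_cons, ← Walk.cons_tail_support w', List.map_cons,
          List.tail_cons]
      · have := hmin p q x s w' hp hq hpq hpx hsq
        rw [Walk.length_cons] at hw
        omega
  rcases key w hp hq hpq hsq hlen with ⟨h, h'⟩ | ⟨x, t, hx, hpx⟩
  · exact Or.inl ⟨h, by rw [h']⟩
  rcases key w.reverse hq hp hpq.symm hpr.symm (by simpa using hlen) with ⟨h, h'⟩ | ⟨y, t', hy, hqy⟩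
  · rw [Walk.support_reverse, List.map_reverse, hx] at h
    simpa using congrArg List.length h
  · rw [Walk.support_reverse, List.map_reverse] at hy
    exact Or.inr ⟨x, y, t, t', hx, hy, hpx, hqy⟩

end IsKConnected

/-! ### Conclusion -/

/-- A longest cycle through `H` that misses a vertex has an ear, contradicting extremality. -/
theorem IsCycleList.mem_of_extremal [DecidableEq V] {G : SimpleGraph V} (hG : IsKConnected G 2)
    {H : Set V} {l : List V} (hl : IsCycleList G l) (hH : ∀ h ∈ H, h ∈ l)
    (S : Extremal G H l.length) (u : V) : u ∈ l := by
  by_contra hu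
  obtain ⟨c, d, hcd, hdc⟩ := hl.closed
  obtain ⟨p, q, r, s, Q, hp, hq, hpq, hQ, hQnd, hQC, hpr, hsq, hor⟩ :=
    hG.exists_shortest_ear (C := {v | v ∈ l}) hu hcd.head_mem hcd.last_mem hdc.ne'
  have hle := le_addClique G H
  obtain ⟨t, e, hperm, hw, hep⟩ := hl.exists_rotation hp
  have hqt : q ∈ t := by
    have := hperm.mem_iff.2 hq
    rw [List.mem_cons] at this
    exact this.resolve_left hpq.symm
  obtain ⟨A, B, rfl⟩ := List.append_of_mem hqt
  have hnd : (Q ++ (p :: (A ++ q :: B))).Nodup := by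
    rw [List.nodup_append']
    exact ⟨hQnd, hperm.nodup_iff.2 hl.nodup, fun v hv hv' => hQC v hv (hperm.mem_iff.1 hv')⟩
  have hlen := hperm.length_eq
  simp only [List.length_cons, List.length_append] at hlen
  have hQlen := List.length_pos_of_ne_nil hQ.ne_nil
  have longer : ∀ (m : List V) (c d : V), WalkList G c m d → G.Adj d c →
      m.Perm (Q ++ (p :: (A ++ q :: B))) → False := by
    intro m c d hm hdc hmp
    have hml := hmp.length_eq
    simp only [List.length_cons, List.length_append] at hml
    have := S.length_le c m d (hm.addClique H) (hle hdc) (hmp.nodup_iff.2 hnd) (by omega)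
      fun h hh => hmp.mem_iff.2 (List.mem_append_right _ (hperm.mem_iff.2 (hH h hh)))
    omega
  -- If `p` and `q` were consecutive on the cycle, the whole ear could be inserted between them.
  have hA : A ≠ [] := by
    rintro rfl
    obtain ⟨p', q', h1, -, h2⟩ := WalkList.split (l := [p]) (m := q :: B) hw (by simp) (by simp)
    obtain rfl : p = p' := by simpa using h1.last
    obtain rfl : q = q' := by simpa using h2.head
    refine longer ([p] ++ (Q ++ (q :: B))) p e (h1.append hpr (hQ.append hsq h2)) hep ?_
    refine List.perm_iff_count.2 fun v => ?_
    simp only [List.count_append, List.count_cons, List.count_nil]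
    omega
  have hB : B ≠ [] := by
    rintro rfl
    obtain rfl : q = e := by
      have := hw.last
      rwa [← List.cons_append, List.getLast?_concat, Option.some.injEq] at this
    refine longer ((p :: (A ++ [q])) ++ Q.reverse) p r (hw.append hsq.symm hQ.reverse) hpr.symm ?_
    refine List.perm_iff_count.2 fun v => ?_
    simp only [List.count_append, List.count_cons, List.count_nil, List.count_reverse]
    omega
  obtain ⟨p', a, h1, hpa, h2⟩ :=
    WalkList.split (l := [p]) (m := A ++ q :: B) hw (by simp) (by simp)
  obtain rfl : p = p' := by simpa using h1.last
  obtain ⟨a', q', hAw, haq, h3⟩ := h2.split hA (by simp)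
  obtain rfl : q = q' := by simpa using h3.head
  obtain ⟨q', b, h4, hqb, hBw⟩ := WalkList.split (l := [q]) (m := B) h3 (by simp) hB
  obtain rfl : q = q' := by simpa using h4.last
  have hcp : (Q ++ (p :: (A ++ q :: B))).Perm (Q ++ p :: q :: (A ++ B)) := by
    refine List.perm_iff_count.2 fun v => ?_
    simp only [List.count_append, List.count_cons]
    omega
  have E : Ear G H l.length r s p q a a' b e Q A B :=
    { walkQ := hQ
      walkA := hAw
      walkB := hBw
      adj_pr := hpr
      adj_sq := hsq
      adj_pa := hpa
      adj_aq := haq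
      adj_qb := hqb
      adj_bp := hep
      nodup := hcp.nodup_iff.1 hnd
      length_eq := by omega
      mem_of_heavy := fun h hh => by
        have := hperm.mem_iff.2 (hH h hh)
        simp only [List.mem_cons, List.mem_append] at this ⊢
        tauto }
  rcases hor with ⟨rfl, rfl⟩ | ⟨w, w', Q₁, Q₂, h1, h2, h3, h4⟩
  · exact E.false_of_single S
  · exact E.false_of_long S h1 h2 h3 h4

/-- A longest cycle through the heavy vertices is chosen in the graph with the clique added, then
replaced by a cycle of `G` containing its vertices. This order makes the latter extremal against
cycles using clique edges too. -/
theorem isHamiltonian_of_localizedCondition [DecidableEq V] {G : SimpleGraph V}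
    [DecidableRel G.Adj] (hG : IsKConnected G 2)
    (h : ∀ S : Set V, (Nonempty (G.induce S ≃g claw) ∨ Nonempty (G.induce S ≃g Z₂)) →
      LocalizedCondition G S 2) : G.IsHamiltonian := by
  classical
  let P : ℕ → Prop := fun n =>
    ∃ l, IsCycleList (addClique G (heavySet G)) l ∧ (∀ v ∈ heavySet G, v ∈ l) ∧ l.length = n
  have hbound : ∀ n, P n → n ≤ Fintype.card V := by
    rintro n ⟨l, hl, -, rfl⟩
    exact hl.nodup.length_le_card
  obtain ⟨l₀, hl₀, hH₀⟩ := hG.exists_cycle_addClique (heavySet G)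
  have hP : P (Nat.findGreatest P (Fintype.card V)) :=
    Nat.findGreatest_spec (hbound _ ⟨l₀, hl₀, hH₀, rfl⟩) ⟨l₀, hl₀, hH₀, rfl⟩
  obtain ⟨l₁, hl₁, hH₁, hlen₁⟩ := hP
  obtain ⟨l, hl, hsub⟩ := exists_cycle_of_addClique (G := G) (H := heavySet G) (fun _ hv => hv) hl₁
  refine hl.isHamiltonian (hl.mem_of_extremal hG (H := heavySet G) (fun v hv => hsub (hH₁ v hv)) ?_)
  refine ⟨fun c x y z hx hy hz => claw_heavy (fun S hS => h S (Or.inl hS)) hx hy hz,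
    fun a b c d e hab hac hbc hcd hde =>
      Z₂_heavy (fun S hS => h S (Or.inr hS)) hab hac hbc hcd hde, fun c m d hm hdc hnd h3 hH => ?_⟩
  have hPm : P m.length := ⟨m, ⟨hnd, h3, c, d, hm, hdc⟩, hH, rfl⟩
  -- As `l` contains the vertices of the longest cycle `l₁`, it is at least as long.
  exact (Nat.le_findGreatest (hbound _ hPm) hPm).trans
    (hlen₁ ▸ (hl₁.nodup.subperm hsub).length_le)

end

end LocalizedHamiltonian

theorem theorem2p1p10 {V : Type*} [Fintype V] [DecidableEq V] (G : SimpleGraph V)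
    [DecidableRel G.Adj] (hG : LocalizedHamiltonian.IsKConnected G 2) :
    ((∀ S : Set V,
        (Nonempty (G.induce S ≃g LocalizedHamiltonian.claw) ∨
          Nonempty (G.induce S ≃g LocalizedHamiltonian.Z₂)) →
        LocalizedHamiltonian.LocalizedCondition G S 2) →
      G.IsHamiltonian) ∧
    ((¬ LocalizedHamiltonian.claw.IsIndContained G ∧
        ¬ LocalizedHamiltonian.Z₂.IsIndContained G) →
      G.IsHamiltonian) := by
  refine ⟨LocalizedHamiltonian.isHamiltonian_of_localizedCondition hG, fun ⟨hclaw, hZ⟩ =>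
    LocalizedHamiltonian.isHamiltonian_of_localizedCondition hG ?_⟩
  -- The localized condition is vacuous, as no such `S` exists.
  rintro S (h | h)
  all_goals obtain ⟨f⟩ := h
  · exact (hclaw ⟨(SimpleGraph.Embedding.induce S).comp f.symm.toEmbedding⟩).elim
  · exact (hZ ⟨(SimpleGraph.Embedding.induce S).comp f.symm.toEmbedding⟩).elim
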